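/- There is an absolute constant $c>0$ such that the following holds. Let $k\ge 1$ be an integer, let $\varepsilon\in(0,1/4]$, let $\mathcal Y$ be a countable message set, and let $\mathcal W$ be any family of channels $W\colon[2k]\to\mathcal Y$, where $[2k]=\{1,\dots,2k\}$ and $W(y\mid x)$ denotes the probability of the message $y$ when the input is $x$. For a channel $W$ let $H(W)$ be the $k\times k$ channel information matrix $$H(W)_{i_1,i_2}=\sum_{y\in\mathcal Y}\frac{\bigl(W(y\mid 2i_1-1)-W(y\mid 2i_1)\bigr)\bigl(W(y\mid 2i_2-1)-W(y\mid 2i_2)\bigr)}{\sum_{x\in[2k]}W(y\mid x)}$$ (with $0/0=0$), and let $\|\mathcal W\|_\ast=\sup_{W\in\mathcal W}\|H(W)\|_\ast$, where $\|\cdot\|_\ast$ is the nuclear norm. Suppose that $n$ users observe independent samples $X_1,\dots,X_n$ from an unknown distribution $p$ on $[2k]$. In a sequentially interactive protocol using $\mathcal W$ there is a public random variable $U$, independent of $(X_1,\dots,X_n)$; for $t=1,\dots,n$, user $t$ selects a channel $W_t\in\mathcal W$ as a function of $(Y_1,\dots,Y_{t-1},U)$ and sends a message $Y_t$ drawn from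 $W_t(\cdot\mid X_t)$. Such a protocol together with a map $\hat p$ from $\mathcal Y^n\times\mathcal U$, where $\mathcal U$ is the set of values of $U$, to the distributions on $[2k]$ is an $(n,\varepsilon)$-estimator using $\mathcal W$ if for every distribution $p$ on $[2k]$, with probability at least $99/100$, the estimate $\hat p(Y_1,\dots,Y_n,U)$ is within total variation distance $\varepsilon$ of $p$. The sample complexity of $(2k,\varepsilon)$-distribution learning under local constraints $\mathcal W$ using interactive protocols is the least $n$ for which an $(n,\varepsilon)$-estimator using $\mathcal W$ exists ($\infty$ if there is none). Then this sample complexity is at least $$c\cdot\frac{k^2}{\varepsilon^2\,\|\mathcal W\|_\ast},$$ where the bound is read as $\infty$ if $\|\mathcal W\|_\ast=0$. -/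

import Mathlib

open MeasureTheory
open scoped ENNReal

universe u v

noncomputable section

namespace InteractiveLearning

/-- A channel `W : [2k] → 𝒴`: the value `W x y` is the probability `W(y ∣ x)` of the message `y` when
the input is `x`. The element `j` of `[2k] = {1, …, 2k}` is the element `j - 1` of `Fin (2 * k)`. -/
abbrev Channel (k : ℕ) (𝒴 : Type u) : Type u := Fin (2 * k) → PMF 𝒴

/-- The input `2i - 1` (for `i` counted from `1`). -/
def oddInput {k : ℕ} (i : Fin k) : Fin (2 * k) := ⟨2 * (i : ℕ), by omega⟩

/-- The input `2i` (for `i` counted from `1`). -/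
def evenInput {k : ℕ} (i : Fin k) : Fin (2 * k) := ⟨2 * (i : ℕ) + 1, by omega⟩

/-- The difference `W(y ∣ 2i - 1) - W(y ∣ 2i)`. -/
def pairDiff {k : ℕ} {𝒴 : Type u} (W : Channel k 𝒴) (i : Fin k) (y : 𝒴) : ℝ :=
  (W (oddInput i) y).toReal - (W (evenInput i) y).toReal

/-- The channel information matrix `H(W)`. A message `y` that has probability `0` under every input
contributes `0 / 0 = 0`. The series is absolutely convergent, since the absolute value of its term
at `y` is at most `W(y ∣ 2i - 1) + W(y ∣ 2i)`. -/
def infoMatrix {k : ℕ} {𝒴 : Type u} (W : Channel k 𝒴) : Matrix (Fin k) (Fin k) ℝ :=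
  Matrix.of fun i j => ∑' y : 𝒴, pairDiff W i y * pairDiff W j y / ∑ x, (W x y).toReal

/-- The nuclear norm of a real square matrix: the sum of its singular values. -/
def nuclearNorm {k : ℕ} (A : Matrix (Fin k) (Fin k) ℝ) : ℝ :=
  ∑ i : Fin k, (Matrix.toEuclideanLin A).singularValues i

/-- The supremum `‖𝒲‖_*` of the nuclear norms of `H(W)` over the channels `W ∈ 𝒲`. -/
def familyNuclearNorm {k : ℕ} {𝒴 : Type u} (𝒲 : Set (Channel k 𝒴)) : ℝ≥0∞ :=
  ⨆ W ∈ 𝒲, ENNReal.ofReal (nuclearNorm (infoMatrix W))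

/-- The simplex `Δ_{2k}` of probability distributions over `[2k]`. -/
abbrev Distribution (k : ℕ) : Type := stdSimplex ℝ (Fin (2 * k))

/-- The total variation distance `sup_S (p(S) - q(S))`. -/
def tvDist {k : ℕ} (p q : Distribution k) : ℝ :=
  ⨆ S : Finset (Fin (2 * k)), ((∑ x ∈ S, p.1 x) - ∑ x ∈ S, q.1 x)

/-- A sequentially interactive protocol for `n` users with channels from `𝒲` and public randomness
in `𝒰`: user `t` selects a channel in `𝒲` as a function of the messages of the preceding users and
of the public randomness. -/
structure Protocol {k : ℕ} {𝒴 : Type u} (𝒲 : Set (Channel k 𝒴)) (𝒰 : Type v)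
    [MeasurableSpace 𝒰] (n : ℕ) where
  /-- the channel selected by user `t`, given the preceding messages and the public randomness -/
  channel : (t : Fin n) → (Fin (t : ℕ) → 𝒴) → 𝒰 → Channel k 𝒴
  channel_mem : ∀ t past r, channel t past r ∈ 𝒲
  measurable_channel : ∀ t past x y, Measurable fun r => channel t past r x y

/-- The messages of the users that precede user `t`. -/
def past {𝒴 : Type u} {n : ℕ} (y : Fin n → 𝒴) (t : Fin n) : Fin (t : ℕ) → 𝒴 :=
  fun s => y ⟨s, s.isLt.trans t.isLt⟩

/-- The probability that the messages `Y^n` are `y`, given that the public randomness is `r`, when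
the inputs `X_1, …, X_n` of the users are independent samples from `p`, independent of the public
randomness, and the message of user `t` is drawn from `W_t(· ∣ X_t)`, where `W_t` is the channel
that the user selects: the sum over all input vectors `x` of the probability of `(x, y)`. -/
def Protocol.messageProb {k : ℕ} {𝒴 : Type u} {𝒲 : Set (Channel k 𝒴)} {𝒰 : Type v}
    [MeasurableSpace 𝒰] {n : ℕ} (P : Protocol 𝒲 𝒰 n) (p : Distribution k) (r : 𝒰)
    (y : Fin n → 𝒴) : ℝ≥0∞ :=
  ∑ x : Fin n → Fin (2 * k),
    ∏ t : Fin n, ENNReal.ofReal (p.1 (x t)) * P.channel t (past y t) r (x t) (y t)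

open Classical in
/-- The probability that the total variation distance between the estimate, computed from the
transcript, and the true distribution `p` exceeds `ε`, when the public randomness has law `μ`. -/
def Protocol.failureProb {k : ℕ} {𝒴 : Type u} {𝒲 : Set (Channel k 𝒴)} {𝒰 : Type v}
    [MeasurableSpace 𝒰] {n : ℕ} (P : Protocol 𝒲 𝒰 n) (μ : Measure 𝒰)
    (est : (Fin n → 𝒴) → 𝒰 → Distribution k) (ε : ℝ) (p : Distribution k) : ℝ≥0∞ :=
  ∫⁻ r, ∑' y : Fin n → 𝒴, (if ε < tvDist (est y r) p then P.messageProb p r y else 0) ∂μ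

/-- There is an `(n, ε)`-estimator using `𝒲`: a sequentially interactive protocol for `n` users,
with some public randomness, and an estimator, a function of the transcript, whose probability of
being more than `ε` away from the true distribution is at most `1/100` for every distribution. -/
def HasEstimator {k : ℕ} {𝒴 : Type u} (𝒲 : Set (Channel k 𝒴)) (n : ℕ) (ε : ℝ) : Prop :=
  ∃ (𝒰 : Type v) (_ : MeasurableSpace 𝒰) (μ : Measure 𝒰) (_ : IsProbabilityMeasure μ)
    (P : Protocol 𝒲 𝒰 n) (est : (Fin n → 𝒴) → 𝒰 → Distribution k),
    (∀ y, Measurable (est y)) ∧ (⨆ p : Distribution k, P.failureProb μ est ε p) ≤ 1 / 100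

/-- The sample complexity of `(2k, ε)`-distribution learning under local constraints `𝒲` using
interactive protocols: the least `n` for which there is an `(n, ε)`-estimator using `𝒲`
(and `⊤` if there is none). -/
def sampleComplexity {k : ℕ} {𝒴 : Type u} (𝒲 : Set (Channel k 𝒴)) (ε : ℝ) : ℕ∞ :=
  ⨅ (n : ℕ) (_ : HasEstimator.{u, v} 𝒲 n ε), (n : ℕ∞)

end InteractiveLearning

end

namespace InteractiveLearning

/-! ### Linear algebra -/

/-! An Assouad-type argument, run directly on adaptive transcripts. Let `z` be uniform on `{±1}^k`
and perturb the uniform distribution on each pair in the direction `z i`, with relative size `γ =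
3ε`. An estimate within `ε` of the truth has a total correlation with `z` that is linear in `k`
(`le_sum_one_add_boolSign_mul_softSign`).

Conversely, the correlation with a single `z i` is limited by the squared Hellinger distance between
the transcript laws for `z` and for `flipAt i z` (`Protocol.two_mul_sum_tsum_messageProb_mul_le`).
That distance is at most an expected sum over users of one-message distances
(`tsum_sq_sqrt_transcriptProb_le`), each at most `4γ²/k` times the entry `H(W) i i` of the channel
in use (`tsum_sq_sqrt_outputProb_le`). Summed over `i`, the entries give a trace, hence at most the
nuclear norm, whichever channel the history selects. So interaction gains nothing: the total
information is at most of order `n ε² ‖𝒲‖_* / k`, and it must be at least of order `k`. -/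

theorem sum_eq_sum_pairs {k : ℕ} {M : Type*} [AddCommMonoid M] (f : Fin (2 * k) → M) :
    ∑ x, f x = ∑ i : Fin k, (f (oddInput i) + f (evenInput i)) := by
  rw [← Equiv.sum_comp (finProdFinEquiv.trans (finCongr (mul_comm k 2))), Fintype.sum_prod_type]
  refine Finset.sum_congr rfl fun i _ => ?_
  rw [Fin.sum_univ_two]
  congr 2 <;> ext <;> simp [oddInput, evenInput, add_comm]

/-- Compute the trace in an orthonormal eigenbasis `b` of `T* T`: there `‖T (b i)‖` is the `i`-th
singular value, and Cauchy–Schwarz bounds each diagonal entry. -/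
theorem trace_le_nuclearNorm {k : ℕ} (A : Matrix (Fin k) (Fin k) ℝ) :
    A.trace ≤ nuclearNorm A := by
  set T := Matrix.toEuclideanLin A with hT
  have hn : Module.finrank ℝ (EuclideanSpace ℝ (Fin k)) = k := by simp
  set b := T.isSymmetric_adjoint_comp_self.eigenvectorBasis hn with hb
  have htr : A.trace = ∑ i, inner ℝ (b i) (T (b i)) := by
    rw [← LinearMap.trace_eq_sum_inner T b,
      LinearMap.trace_eq_sum_inner T (EuclideanSpace.basisFun (Fin k) ℝ), Matrix.trace]
    refine Finset.sum_congr rfl fun i _ => ?_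
    simp [hT, Matrix.toEuclideanLin, EuclideanSpace.inner_single_left]
  rw [htr, nuclearNorm]
  refine Finset.sum_le_sum fun i _ => ?_
  have hnorm : ‖T (b i)‖ = T.singularValues i := by
    refine (sq_eq_sq₀ (norm_nonneg _) (T.singularValues_nonneg i)).1 ?_
    rw [T.sq_singularValues_fin hn, ← real_inner_self_eq_norm_sq, ← LinearMap.adjoint_inner_right,
      ← LinearMap.comp_apply, hb, LinearMap.IsSymmetric.apply_eigenvectorBasis]
    simp [inner_smul_right]
  calc inner ℝ (b i) (T (b i)) ≤ ‖b i‖ * ‖T (b i)‖ := real_inner_le_norm _ _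
    _ = T.singularValues i := by simp [hnorm]

/-! ### Squared Hellinger distance of transcripts -/

theorem sq_sqrt_sub_sqrt_le_add {a b : ℝ} (ha : 0 ≤ a) (hb : 0 ≤ b) :
    (√a - √b) ^ 2 ≤ a + b := by
  nlinarith [Real.sq_sqrt ha, Real.sq_sqrt hb, Real.sqrt_nonneg a, Real.sqrt_nonneg b,
    mul_nonneg (Real.sqrt_nonneg a) (Real.sqrt_nonneg b)]

/-- One step of the subadditivity of the squared Hellinger distance. -/
theorem tsum_sq_sqrt_mul_sub_le {𝒴 : Type*} {A B : ℝ} {a b : 𝒴 → ℝ} (hA : 0 ≤ A) (hB : 0 ≤ B)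
    (ha : ∀ v, 0 ≤ a v) (hb : ∀ v, 0 ≤ b v) (hsa : HasSum a 1) (hsb : HasSum b 1) :
    ∑' v, ENNReal.ofReal ((√(A * a v) - √(B * b v)) ^ 2) ≤
      ENNReal.ofReal ((√A - √B) ^ 2) +
        ENNReal.ofReal ((A + B) / 2) * ∑' v, ENNReal.ofReal ((√(a v) - √(b v)) ^ 2) := by
  have hsum : Summable fun v => (√(a v) - √(b v)) ^ 2 :=
    (hsa.summable.add hsb.summable).of_nonneg_of_le (fun _ => sq_nonneg _)
      fun v => sq_sqrt_sub_sqrt_le_add (ha v) (hb v)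
  rw [← ENNReal.ofReal_tsum_of_nonneg (fun _ => sq_nonneg _) hsum,
    ← ENNReal.ofReal_mul (by positivity),
    ← ENNReal.ofReal_add (sq_nonneg _)
      (mul_nonneg (by positivity) (tsum_nonneg fun _ => sq_nonneg _))]
  -- The summand is expanded so that only `a v`, `b v` and the conditional Hellinger term depend on
  -- `v`; the first two coefficients add up to `(√A - √B)²`. AM-GM then replaces `√A √B` by `(A + B)
  -- / 2`.
  have hsum' : HasSum (fun v => √A * (√A - √B) * a v + √B * (√B - √A) * b v
      + √A * √B * (√(a v) - √(b v)) ^ 2)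
      (√A * (√A - √B) * 1 + √B * (√B - √A) * 1 + √A * √B * ∑' v, (√(a v) - √(b v)) ^ 2) :=
    ((hsa.mul_left _).add (hsb.mul_left _)).add (hsum.hasSum.mul_left _)
  have hterm : ∀ v, √A * (√A - √B) * a v + √B * (√B - √A) * b v
      + √A * √B * (√(a v) - √(b v)) ^ 2 = (√(A * a v) - √(B * b v)) ^ 2 := fun v => by
    rw [Real.sqrt_mul hA, Real.sqrt_mul hB]
    nth_rewrite 1 [← Real.sq_sqrt (ha v)]
    nth_rewrite 1 [← Real.sq_sqrt (hb v)]
    ring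
  simp only [hterm] at hsum'
  rw [← ENNReal.ofReal_tsum_of_nonneg (fun _ => sq_nonneg _) hsum'.summable, hsum'.tsum_eq]
  apply ENNReal.ofReal_le_ofReal
  have hAB : √A * √B ≤ (A + B) / 2 := by
    nlinarith [Real.sq_sqrt hA, Real.sq_sqrt hB, sq_nonneg (√A - √B)]
  have hD : 0 ≤ ∑' v, (√(a v) - √(b v)) ^ 2 := tsum_nonneg fun v => sq_nonneg _
  nlinarith [mul_le_mul_of_nonneg_right hAB hD]

/-- The probability of the transcript `y` when the message of user `t` has the law
`w t (past y t)` given the preceding messages. -/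
noncomputable def transcriptProb {𝒴 : Type u} {n : ℕ} (w : (t : Fin n) → (Fin (t : ℕ) → 𝒴) → 𝒴 → ℝ)
    (y : Fin n → 𝒴) : ℝ :=
  ∏ t, w t (past y t) (y t)

theorem past_snoc_castSucc {𝒴 : Type u} {n : ℕ} (y : Fin n → 𝒴) (v : 𝒴) (t : Fin n) :
    past (Fin.snoc y v : Fin (n + 1) → 𝒴) t.castSucc = past y t := by
  funext s
  exact Fin.snoc_castSucc (α := fun _ => 𝒴) v y ⟨s, s.isLt.trans t.isLt⟩

theorem past_snoc_last {𝒴 : Type u} {n : ℕ} (y : Fin n → 𝒴) (v : 𝒴) :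
    past (Fin.snoc y v : Fin (n + 1) → 𝒴) (Fin.last n) = y := by
  funext s
  exact Fin.snoc_castSucc (α := fun _ => 𝒴) v y s

theorem transcriptProb_snoc {𝒴 : Type u} {n : ℕ}
    (w : (t : Fin (n + 1)) → (Fin (t : ℕ) → 𝒴) → 𝒴 → ℝ) (y : Fin n → 𝒴) (v : 𝒴) :
    transcriptProb w (Fin.snoc y v : Fin (n + 1) → 𝒴) =
      transcriptProb (fun t => w t.castSucc) y * w (Fin.last n) y v := by
  rw [transcriptProb, Fin.prod_univ_castSucc, past_snoc_last]
  simp only [past_snoc_castSucc, Fin.snoc_castSucc, Fin.snoc_last]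
  rfl

theorem transcriptProb_nonneg {𝒴 : Type u} {n : ℕ}
    {w : (t : Fin n) → (Fin (t : ℕ) → 𝒴) → 𝒴 → ℝ} (hw : ∀ t h v, 0 ≤ w t h v) (y : Fin n → 𝒴) :
    0 ≤ transcriptProb w y :=
  Finset.prod_nonneg fun _ _ => hw _ _ _

theorem tsum_snoc {𝒴 : Type u} {n : ℕ} (f : (Fin (n + 1) → 𝒴) → ℝ≥0∞) :
    ∑' y, f y = ∑' (y : Fin n → 𝒴) (v : 𝒴), f (Fin.snoc y v : Fin (n + 1) → 𝒴) := by
  rw [← (Fin.snocEquiv fun _ : Fin (n + 1) => 𝒴).tsum_eq, ENNReal.tsum_prod', ENNReal.tsum_comm]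
  rfl

theorem tsum_ofReal_eq_one {ι : Type*} {f : ι → ℝ} (hf : ∀ i, 0 ≤ f i) (h : HasSum f 1) :
    ∑' i, ENNReal.ofReal (f i) = 1 := by
  rw [← ENNReal.ofReal_tsum_of_nonneg hf h.summable, h.tsum_eq, ENNReal.ofReal_one]

/-- The weight `f` ignores the last message, whose conditional law has total mass one and therefore
sums out. -/
theorem tsum_snoc_transcriptProb_mul {𝒴 : Type u} {n : ℕ}
    {w : (t : Fin (n + 1)) → (Fin (t : ℕ) → 𝒴) → 𝒴 → ℝ} (hw : ∀ t h v, 0 ≤ w t h v)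
    (hw1 : ∀ t h, HasSum (w t h) 1) (f : (Fin n → 𝒴) → ℝ≥0∞) :
    ∑' (y : Fin n → 𝒴) (v : 𝒴),
        ENNReal.ofReal (transcriptProb w (Fin.snoc y v : Fin (n + 1) → 𝒴)) * f y =
      ∑' y, ENNReal.ofReal (transcriptProb (fun t => w t.castSucc) y) * f y := by
  refine tsum_congr fun y => ?_
  simp only [transcriptProb_snoc]
  rw [ENNReal.tsum_mul_right]
  simp only [ENNReal.ofReal_mul (transcriptProb_nonneg (fun t : Fin n => hw t.castSucc) y)]
  rw [ENNReal.tsum_mul_left, tsum_ofReal_eq_one (hw _ _) (hw1 _ _), mul_one]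

theorem tsum_transcriptProb {𝒴 : Type u} : ∀ {n : ℕ}
    {w : (t : Fin n) → (Fin (t : ℕ) → 𝒴) → 𝒴 → ℝ} (_ : ∀ t h v, 0 ≤ w t h v)
    (_ : ∀ t h, HasSum (w t h) 1), ∑' y, ENNReal.ofReal (transcriptProb w y) = 1
  | 0, w, _, _ => by
    rw [tsum_fintype]
    simp [transcriptProb]
  | n + 1, w, hw, hw1 => by
    have h := tsum_snoc_transcriptProb_mul hw hw1 fun _ => 1
    simp only [mul_one] at h
    rw [tsum_snoc, h]
    exact tsum_transcriptProb (fun t : Fin n => hw t.castSucc) fun t => hw1 t.castSucc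

/-- The squared Hellinger distance of two laws of the transcript is at most the expected sum of the
squared Hellinger distances of the conditional laws of the messages. -/
theorem tsum_sq_sqrt_transcriptProb_le {𝒴 : Type u} : ∀ {n : ℕ}
    {a b : (t : Fin n) → (Fin (t : ℕ) → 𝒴) → 𝒴 → ℝ}
    (_ : ∀ t h v, 0 ≤ a t h v) (_ : ∀ t h v, 0 ≤ b t h v)
    (_ : ∀ t h, HasSum (a t h) 1) (_ : ∀ t h, HasSum (b t h) 1)
    (d : (t : Fin n) → (Fin (t : ℕ) → 𝒴) → ℝ≥0∞)
    (_ : ∀ t h, ∑' v, ENNReal.ofReal ((√(a t h v) - √(b t h v)) ^ 2) ≤ d t h),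
    ∑' y, ENNReal.ofReal ((√(transcriptProb a y) - √(transcriptProb b y)) ^ 2) ≤
      2⁻¹ * ∑' y, (ENNReal.ofReal (transcriptProb a y) + ENNReal.ofReal (transcriptProb b y)) *
        ∑ t, d t (past y t)
  | 0, a, b, _, _, _, _, d, _ => by
    simp [transcriptProb]
  | n + 1, a, b, ha, hb, ha1, hb1, d, hd => by
    have ih := tsum_sq_sqrt_transcriptProb_le (fun t : Fin n => ha t.castSucc)
      (fun t => hb t.castSucc) (fun t => ha1 t.castSucc) (fun t => hb1 t.castSucc)
      (fun t => d t.castSucc) fun t => hd t.castSucc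
    set a' := fun t : Fin n => a t.castSucc with ha'
    set b' := fun t : Fin n => b t.castSucc with hb'
    have hA := fun y => transcriptProb_nonneg (w := a') (fun t : Fin n => ha t.castSucc) y
    have hB := fun y => transcriptProb_nonneg (w := b') (fun t : Fin n => hb t.castSucc) y
    -- Each `d t` depends only on the messages before `t`, so the last message sums out of the
    -- right-hand side.
    have hR : ∑' y, (ENNReal.ofReal (transcriptProb a y) + ENNReal.ofReal (transcriptProb b y)) *
        ∑ t, d t (past y t) =
      ∑' y, (ENNReal.ofReal (transcriptProb a' y) + ENNReal.ofReal (transcriptProb b' y)) *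
        (∑ t : Fin n, d t.castSucc (past y t) + d (Fin.last n) y) := by
      rw [tsum_snoc]
      simp only [Fin.sum_univ_castSucc, past_snoc_castSucc, past_snoc_last, add_mul (R := ℝ≥0∞),
        ENNReal.tsum_add]
      have h1 := tsum_snoc_transcriptProb_mul ha ha1 fun y =>
        (∑ t : Fin n, d t.castSucc (past y t) + d (Fin.last n) y)
      have h2 := tsum_snoc_transcriptProb_mul hb hb1 fun y =>
        (∑ t : Fin n, d t.castSucc (past y t) + d (Fin.last n) y)
      exact congrArg₂ (· + ·) h1 h2
    rw [hR, tsum_snoc]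
    simp only [mul_add, ENNReal.tsum_add]
    refine le_trans ?_ (add_le_add_left ih _)
    rw [← ENNReal.tsum_mul_left, ← ENNReal.tsum_add]
    refine ENNReal.tsum_le_tsum fun y => ?_
    simp only [transcriptProb_snoc]
    refine (tsum_sq_sqrt_mul_sub_le (hA y) (hB y) (ha _ _) (hb _ _) (ha1 _ _) (hb1 _ _)).trans ?_
    refine add_le_add le_rfl ?_
    have hhalf : ENNReal.ofReal ((transcriptProb a' y + transcriptProb b' y) / 2) =
        2⁻¹ * (ENNReal.ofReal (transcriptProb a' y) + ENNReal.ofReal (transcriptProb b' y)) := by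
      rw [← ENNReal.ofReal_add (hA y) (hB y), ENNReal.ofReal_div_of_pos two_pos,
        ENNReal.ofReal_ofNat, ENNReal.div_eq_inv_mul]
    rw [hhalf, mul_assoc]
    gcongr
    exact hd _ _

/-! ### Perturbations of the uniform distribution -/

/-- The sign `±1` encoded by a Boolean. -/
def boolSign (b : Bool) : ℝ := if b then 1 else -1

theorem boolSign_not (b : Bool) : boolSign (!b) = -boolSign b := by
  cases b <;> simp [boolSign]

theorem boolSign_eq (b : Bool) : boolSign b = 1 ∨ boolSign b = -1 := by
  cases b <;> simp [boolSign]

theorem boolSign_mul_self (b : Bool) : boolSign b * boolSign b = 1 := by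
  cases b <;> simp [boolSign]

/-- The vector `z` with its coordinate `i` flipped. -/
def flipAt {k : ℕ} (i : Fin k) (z : Fin k → Bool) : Fin k → Bool := Function.update z i (!z i)

theorem flipAt_involutive {k : ℕ} (i : Fin k) : Function.Involutive (flipAt i) := fun z => by
  simp [flipAt]

theorem flipAt_same {k : ℕ} (i : Fin k) (z : Fin k → Bool) : flipAt i z i = !z i := by
  simp [flipAt]

theorem flipAt_of_ne {k : ℕ} {i j : Fin k} (h : j ≠ i) (z : Fin k → Bool) :
    flipAt i z j = z j := by
  simp [flipAt, h]

/-- The mass at `x` of the perturbation of the uniform distribution on `[2k]` that moves mass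
`γ / 2k` between the elements `2i - 1` and `2i`, in the direction given by `z i`. -/
noncomputable def perturbedMass {k : ℕ} (γ : ℝ) (z : Fin k → Bool) (x : Fin (2 * k)) : ℝ :=
  (1 + γ * ((if (x : ℕ) % 2 = 0 then 1 else -1) * boolSign (z ⟨(x : ℕ) / 2, by omega⟩))) / (2 * k)

theorem perturbedMass_oddInput {k : ℕ} (γ : ℝ) (z : Fin k → Bool) (i : Fin k) :
    perturbedMass γ z (oddInput i) = (1 + γ * boolSign (z i)) / (2 * k) := by
  simp [perturbedMass, oddInput]

theorem perturbedMass_evenInput {k : ℕ} (γ : ℝ) (z : Fin k → Bool) (i : Fin k) :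
    perturbedMass γ z (evenInput i) = (1 - γ * boolSign (z i)) / (2 * k) := by
  have h1 : (2 * (i : ℕ) + 1) / 2 = i := by omega
  have h2 : (2 * (i : ℕ) + 1) % 2 = 1 := by omega
  simp [perturbedMass, evenInput, h1, h2, sub_eq_add_neg]

theorem le_perturbedMass {k : ℕ} {γ : ℝ} (hγ : 0 ≤ γ) (z : Fin k → Bool) (x : Fin (2 * k)) :
    (1 - γ) / (2 * k) ≤ perturbedMass γ z x := by
  unfold perturbedMass
  gcongr
  rcases boolSign_eq (z ⟨(x : ℕ) / 2, by omega⟩) with h | h <;> rw [h] <;> split_ifs <;> linarith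

theorem sum_perturbedMass {k : ℕ} (hk : 1 ≤ k) (γ : ℝ) (z : Fin k → Bool) :
    ∑ x, perturbedMass γ z x = 1 := by
  have hk' : (k : ℝ) ≠ 0 := by positivity
  rw [sum_eq_sum_pairs]
  have : ∀ i : Fin k, perturbedMass γ z (oddInput i) + perturbedMass γ z (evenInput i) = 1 / k :=
    fun i => by rw [perturbedMass_oddInput, perturbedMass_evenInput]; field_simp; ring
  simp [this, hk']

/-- The perturbed uniform distribution as an element of the simplex. -/
noncomputable def perturbed {k : ℕ} (hk : 1 ≤ k) {γ : ℝ} (hγ : 0 ≤ γ) (hγ1 : γ ≤ 1)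
    (z : Fin k → Bool) : Distribution k :=
  ⟨perturbedMass γ z, fun x => le_trans (div_nonneg (by linarith) (by positivity))
    (le_perturbedMass hγ z x), sum_perturbedMass hk γ z⟩

/-! ### Total variation distance -/

/-- Test the supremum on `{q ≤ p}`: since `|a| = 2a⁺ - a` and the signed differences sum to zero,
the `ℓ¹` distance is twice the positive part. -/
theorem sum_abs_sub_le_two_mul_tvDist {k : ℕ} (p q : Distribution k) :
    ∑ x, |p.1 x - q.1 x| ≤ 2 * tvDist p q := by
  set S : Finset (Fin (2 * k)) := Finset.univ.filter fun x => q.1 x ≤ p.1 x with hS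
  have h1 : (∑ x ∈ S, p.1 x) - ∑ x ∈ S, q.1 x ≤ tvDist p q :=
    le_ciSup (f := fun S : Finset (Fin (2 * k)) => (∑ x ∈ S, p.1 x) - ∑ x ∈ S, q.1 x)
      (Set.finite_range _).bddAbove S
  have h0 : ∑ x, (p.1 x - q.1 x) = 0 := by
    rw [Finset.sum_sub_distrib, p.2.2, q.2.2, sub_self]
  have h2 : ∀ x, |p.1 x - q.1 x| = 2 * (if q.1 x ≤ p.1 x then p.1 x - q.1 x else 0)
      - (p.1 x - q.1 x) := fun x => by
    split_ifs with h
    · rw [abs_of_nonneg (by linarith)]; ring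
    · rw [abs_of_nonpos (by linarith)]; ring
  rw [Finset.sum_congr rfl fun x _ => h2 x, Finset.sum_sub_distrib, h0, ← Finset.mul_sum,
    ← Finset.sum_filter, Finset.sum_sub_distrib]
  linarith

/-- The guess for the direction of the perturbation of the pair `i` that the distribution `p`
provides, a number in `[-1, 1]`. -/
noncomputable def softSign {k : ℕ} (γ : ℝ) (p : Distribution k) (i : Fin k) : ℝ :=
  max (-1) (min 1 (k * (p.1 (oddInput i) - p.1 (evenInput i)) / γ))

theorem abs_softSign_le {k : ℕ} (γ : ℝ) (p : Distribution k) (i : Fin k) :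
    |softSign γ p i| ≤ 1 :=
  abs_le.2 ⟨le_max_left _ _, max_le (by norm_num) (min_le_left _ _)⟩

/-- For `s` in `[-1, 1]` and a sign `b`, `1 - b s = |s - b|`; clipping to `[-1, 1]` fixes `b` and
does not increase distances. -/
theorem one_sub_boolSign_mul_softSign_le {k : ℕ} (γ : ℝ) (p : Distribution k) (i : Fin k)
    (b : Bool) : 1 - boolSign b * softSign γ p i ≤
      |k * (p.1 (oddInput i) - p.1 (evenInput i)) / γ - boolSign b| := by
  unfold softSign
  set d := k * (p.1 (oddInput i) - p.1 (evenInput i)) / γ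
  rcases boolSign_eq b with h | h <;> rw [h]
  · rcases max_cases (-1) (min 1 d) with h1 | h1 <;> rcases min_cases 1 d with h2 | h2 <;>
      rcases abs_cases (d - 1) with h3 | h3 <;> linarith
  · rcases max_cases (-1) (min 1 d) with h1 | h1 <;> rcases min_cases 1 d with h2 | h2 <;>
      rcases abs_cases (d - -1) with h3 | h3 <;> linarith

/-- An estimate close to a perturbed distribution correlates with the perturbation. -/
theorem le_sum_one_add_boolSign_mul_softSign {k : ℕ} (hk : 1 ≤ k) {γ ε : ℝ} (hγ : 0 < γ)
    (hγ1 : γ ≤ 1) (z : Fin k → Bool) {p : Distribution k}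
    (h : tvDist p (perturbed hk hγ.le hγ1 z) ≤ ε) :
    2 * k * (1 - ε / γ) ≤ ∑ i, (1 + boolSign (z i) * softSign γ p i) := by
  have hk' : (0 : ℝ) < k := by positivity
  have h1 := sum_abs_sub_le_two_mul_tvDist p (perturbed hk hγ.le hγ1 z)
  rw [sum_eq_sum_pairs] at h1
  have h2 : ∀ i : Fin k, 1 - boolSign (z i) * softSign γ p i ≤
      k / γ * (|p.1 (oddInput i) - (perturbed hk hγ.le hγ1 z).1 (oddInput i)| +
        |p.1 (evenInput i) - (perturbed hk hγ.le hγ1 z).1 (evenInput i)|) := fun i => by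
    refine (one_sub_boolSign_mul_softSign_le γ p i (z i)).trans ?_
    -- For the perturbed distribution itself, the rescaled pair difference is exactly `boolSign (z
    -- i)`.
    have h3 : k * (p.1 (oddInput i) - p.1 (evenInput i)) / γ - boolSign (z i) =
        k / γ * ((p.1 (oddInput i) - (perturbed hk hγ.le hγ1 z).1 (oddInput i)) -
          (p.1 (evenInput i) - (perturbed hk hγ.le hγ1 z).1 (evenInput i))) := by
      simp only [perturbed, perturbedMass_oddInput, perturbedMass_evenInput]
      field_simp
      ring
    rw [h3, abs_mul, abs_of_pos (by positivity)]
    gcongr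
    exact abs_sub _ _
  have h4 := Finset.sum_le_sum fun i (_ : i ∈ Finset.univ) => h2 i
  rw [← Finset.mul_sum] at h4
  have h5 : (k : ℝ) / γ * (∑ i : Fin k,
      (|p.1 (oddInput i) - (perturbed hk hγ.le hγ1 z).1 (oddInput i)| +
        |p.1 (evenInput i) - (perturbed hk hγ.le hγ1 z).1 (evenInput i)|)) ≤ k / γ * (2 * ε) := by
    gcongr
    linarith
  have h6 : (k : ℝ) / γ * (2 * ε) = 2 * k * (ε / γ) := by ring
  rw [Finset.sum_sub_distrib] at h4
  rw [Finset.sum_add_distrib]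
  simp only [Finset.sum_const, Finset.card_univ, Fintype.card_fin, nsmul_eq_mul, mul_one] at h4 ⊢
  linarith

/-! ### The information matrix -/

/-- The law of the message when the input has the law `p`. -/
noncomputable def outputProb {k : ℕ} {𝒴 : Type u} (p : Fin (2 * k) → ℝ) (W : Channel k 𝒴) (v : 𝒴) :
    ℝ :=
  ∑ x, p x * (W x v).toReal

theorem outputProb_nonneg {k : ℕ} {𝒴 : Type u} {p : Fin (2 * k) → ℝ} (hp : ∀ x, 0 ≤ p x)
    (W : Channel k 𝒴) (v : 𝒴) : 0 ≤ outputProb p W v :=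
  Finset.sum_nonneg fun x _ => mul_nonneg (hp x) ENNReal.toReal_nonneg

theorem hasSum_toReal_pmf {𝒴 : Type u} (W : PMF 𝒴) : HasSum (fun v => (W v).toReal) 1 := by
  have := ENNReal.hasSum_toReal W.tsum_coe_ne_top
  rwa [← ENNReal.tsum_toReal_eq W.apply_ne_top, W.tsum_coe, ENNReal.toReal_one] at this

theorem hasSum_outputProb {k : ℕ} {𝒴 : Type u} (p : Distribution k) (W : Channel k 𝒴) :
    HasSum (outputProb p.1 W) 1 := by
  have h := hasSum_sum fun x (_ : x ∈ Finset.univ) => (hasSum_toReal_pmf (W x)).mul_left (p.1 x)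
  simp only [mul_one, p.2.2] at h
  exact h

theorem sq_sqrt_sub_sqrt_le_div {a b : ℝ} (ha : 0 ≤ a) (hb : 0 ≤ b) (h : 0 < a + b) :
    (√a - √b) ^ 2 ≤ (a - b) ^ 2 / (a + b) := by
  rw [le_div_iff₀ h]
  have h1 : (a - b) ^ 2 = (√a - √b) ^ 2 * (√a + √b) ^ 2 := by
    nth_rewrite 1 [← Real.sq_sqrt ha, ← Real.sq_sqrt hb]
    ring
  rw [h1]
  gcongr
  nlinarith [Real.sq_sqrt ha, Real.sq_sqrt hb, mul_nonneg (Real.sqrt_nonneg a) (Real.sqrt_nonneg b)]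

theorem outputProb_sub_flipAt {k : ℕ} {𝒴 : Type u} (γ : ℝ) (z : Fin k → Bool) (i : Fin k)
    (W : Channel k 𝒴) (v : 𝒴) :
    outputProb (perturbedMass γ z) W v - outputProb (perturbedMass γ (flipAt i z)) W v =
      γ / k * boolSign (z i) * pairDiff W i v := by
  unfold outputProb
  rw [← Finset.sum_sub_distrib, sum_eq_sum_pairs, Finset.sum_eq_single i]
  · simp only [perturbedMass_oddInput, perturbedMass_evenInput, flipAt_same, boolSign_not, pairDiff]
    ring
  · intro j _ hj
    simp [perturbedMass_oddInput, perturbedMass_evenInput, flipAt_of_ne hj]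
  · simp

/-- Makes the message probabilities comparable with the denominator in `infoMatrix`. -/
theorem le_outputProb_perturbedMass {k : ℕ} {𝒴 : Type u} {γ : ℝ} (hγ : 0 ≤ γ)
    (z : Fin k → Bool) (W : Channel k 𝒴) (v : 𝒴) :
    (1 - γ) / (2 * k) * ∑ x, (W x v).toReal ≤ outputProb (perturbedMass γ z) W v := by
  rw [Finset.mul_sum]
  exact Finset.sum_le_sum fun x _ =>
    mul_le_mul_of_nonneg_right (le_perturbedMass hγ z x) ENNReal.toReal_nonneg

/-- Needed because a real `tsum` that does not converge is `0`. Convergence follows from `|pairDiff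
W i v| ≤ ∑ x, W(v ∣ x)`. -/
theorem summable_pairDiff_mul_self_div {k : ℕ} {𝒴 : Type u} (W : Channel k 𝒴) (i : Fin k) :
    Summable fun v => pairDiff W i v * pairDiff W i v / ∑ x, (W x v).toReal := by
  refine Summable.of_nonneg_of_le
    (fun v => div_nonneg (mul_self_nonneg _) (Finset.sum_nonneg fun _ _ => ENNReal.toReal_nonneg))
    (fun v => ?_) (summable_sum fun x (_ : x ∈ Finset.univ) => (hasSum_toReal_pmf (W x)).summable)
  have hS : 0 ≤ ∑ x, (W x v).toReal := Finset.sum_nonneg fun _ _ => ENNReal.toReal_nonneg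
  have hle : ∀ x, (W x v).toReal ≤ ∑ x, (W x v).toReal := fun x =>
    Finset.single_le_sum (f := fun x => (W x v).toReal) (fun _ _ => ENNReal.toReal_nonneg)
      (Finset.mem_univ x)
  refine div_le_of_le_mul₀ hS hS ?_
  have h1 := hle (oddInput i)
  have h2 := hle (evenInput i)
  have h3 : 0 ≤ (W (oddInput i) v).toReal := ENNReal.toReal_nonneg
  have h4 : 0 ≤ (W (evenInput i) v).toReal := ENNReal.toReal_nonneg
  refine abs_le_iff_mul_self_le.1 ?_
  rw [abs_of_nonneg hS, pairDiff, abs_le]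
  constructor <;> linarith

/-- Flipping one pair changes the law of a message, in squared Hellinger distance, by at most a
multiple of the corresponding diagonal entry of the information matrix. -/
theorem tsum_sq_sqrt_outputProb_le {k : ℕ} (hk : 1 ≤ k) {𝒴 : Type u} {γ : ℝ} (hγ : 0 ≤ γ)
    (hγ1 : γ ≤ 3 / 4) (z : Fin k → Bool) (i : Fin k) (W : Channel k 𝒴) :
    ∑' v, ENNReal.ofReal ((√(outputProb (perturbedMass γ z) W v) -
        √(outputProb (perturbedMass γ (flipAt i z)) W v)) ^ 2) ≤
      ENNReal.ofReal (4 * γ ^ 2 / k) * ENNReal.ofReal (infoMatrix W i i) := by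
  have hk' : (0 : ℝ) < k := by positivity
  rw [← ENNReal.ofReal_mul (by positivity), infoMatrix, Matrix.of_apply, ← tsum_mul_left,
    ENNReal.ofReal_tsum_of_nonneg (fun v => mul_nonneg (by positivity) (div_nonneg
      (mul_self_nonneg _) (Finset.sum_nonneg fun _ _ => ENNReal.toReal_nonneg)))
      ((summable_pairDiff_mul_self_div W i).mul_left _)]
  refine ENNReal.tsum_le_tsum fun v => ENNReal.ofReal_le_ofReal ?_
  have hnn : ∀ z : Fin k → Bool, 0 ≤ outputProb (perturbedMass γ z) W v := fun z =>
    outputProb_nonneg (perturbed hk hγ (by linarith) z).2.1 W v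
  have hS : 0 ≤ ∑ x, (W x v).toReal := Finset.sum_nonneg fun _ _ => ENNReal.toReal_nonneg
  have ha := le_outputProb_perturbedMass hγ z W v
  have hb := le_outputProb_perturbedMass hγ (flipAt i z) W v
  have hab := outputProb_sub_flipAt γ z i W v
  set S := ∑ x, (W x v).toReal
  -- A message impossible under every input has probability `0` under both laws, in agreement with
  -- `0 / 0 = 0`.
  rcases hS.eq_or_lt with h0 | hpos
  · have hz : ∀ z : Fin k → Bool, outputProb (perturbedMass γ z) W v = 0 := fun z => by
      have : ∀ x, (W x v).toReal = 0 := fun x =>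
        (Finset.sum_eq_zero_iff_of_nonneg fun _ _ => ENNReal.toReal_nonneg).1 h0.symm x
          (Finset.mem_univ x)
      simp [outputProb, this]
    simp [hz, ← h0]
  -- As `γ ≤ 3/4`, each of the two probabilities is at least `S / (8k)`; this is the source of the
  -- factor `4`.
  · have hge : S / (4 * k) ≤ outputProb (perturbedMass γ z) W v +
        outputProb (perturbedMass γ (flipAt i z)) W v := by
      have : S / (4 * k) = (1 / 4) / (2 * k) * S + (1 / 4) / (2 * k) * S := by ring
      rw [this]
      refine add_le_add (le_trans ?_ ha) (le_trans ?_ hb) <;> gcongr <;> linarith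
    refine (sq_sqrt_sub_sqrt_le_div (hnn _) (hnn _)
      (lt_of_lt_of_le (by positivity) hge)).trans ?_
    rw [hab]
    calc (γ / k * boolSign (z i) * pairDiff W i v) ^ 2 / _
        ≤ (γ / k * boolSign (z i) * pairDiff W i v) ^ 2 / (S / (4 * k)) := by gcongr
      _ = boolSign (z i) * boolSign (z i) *
          (4 * γ ^ 2 / k * (pairDiff W i v * pairDiff W i v / S)) := by
        field_simp
      _ = _ := by rw [boolSign_mul_self, one_mul]

theorem infoMatrix_diag_nonneg {k : ℕ} {𝒴 : Type u} (W : Channel k 𝒴) (i : Fin k) :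
    0 ≤ infoMatrix W i i :=
  tsum_nonneg fun _ => div_nonneg (mul_self_nonneg _)
    (Finset.sum_nonneg fun _ _ => ENNReal.toReal_nonneg)

theorem sum_ofReal_infoMatrix_diag_le {k : ℕ} {𝒴 : Type u} {𝒲 : Set (Channel k 𝒴)}
    {W : Channel k 𝒴} (hW : W ∈ 𝒲) :
    ∑ i, ENNReal.ofReal (infoMatrix W i i) ≤ familyNuclearNorm 𝒲 := by
  rw [← ENNReal.ofReal_sum_of_nonneg fun i _ => infoMatrix_diag_nonneg W i]
  exact (ENNReal.ofReal_le_ofReal (trace_le_nuclearNorm (infoMatrix W))).trans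
    (le_iSup₂ (f := fun W (_ : W ∈ 𝒲) => ENNReal.ofReal (nuclearNorm (infoMatrix W))) W hW)

/-! ### The lower bound -/

/-- The law of the message of each user of a protocol, given the preceding messages. -/
noncomputable def Protocol.step {k : ℕ} {𝒴 : Type u} {𝒲 : Set (Channel k 𝒴)} {𝒰 : Type v}
    [MeasurableSpace 𝒰] {n : ℕ} (P : Protocol 𝒲 𝒰 n) (p : Distribution k) (r : 𝒰)
    (t : Fin n) (h : Fin (t : ℕ) → 𝒴) (v : 𝒴) : ℝ :=
  outputProb p.1 (P.channel t h r) v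

section

variable {k : ℕ} {𝒴 : Type u} {𝒲 : Set (Channel k 𝒴)} {𝒰 : Type v} [MeasurableSpace 𝒰] {n : ℕ}

theorem Protocol.step_nonneg (P : Protocol 𝒲 𝒰 n) (p : Distribution k) (r : 𝒰) (t : Fin n)
    (h : Fin (t : ℕ) → 𝒴) (v : 𝒴) : 0 ≤ P.step p r t h v :=
  outputProb_nonneg p.2.1 _ _

/-- Once `y` and `r` are fixed, so are all the channels, and the sum over input vectors factors over
the users. -/
theorem Protocol.messageProb_eq (P : Protocol 𝒲 𝒰 n) (p : Distribution k) (r : 𝒰)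
    (y : Fin n → 𝒴) : P.messageProb p r y = ENNReal.ofReal (transcriptProb (P.step p r) y) := by
  rw [transcriptProb, ENNReal.ofReal_prod_of_nonneg fun t _ => P.step_nonneg p r t _ _,
    Protocol.messageProb]
  have h : ∀ t, ENNReal.ofReal (P.step p r t (past y t) (y t)) =
      ∑ x, ENNReal.ofReal (p.1 x) * P.channel t (past y t) r x (y t) := fun t => by
    rw [Protocol.step, outputProb, ENNReal.ofReal_sum_of_nonneg fun x _ =>
      mul_nonneg (p.2.1 x) ENNReal.toReal_nonneg]
    refine Finset.sum_congr rfl fun x _ => ?_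
    rw [ENNReal.ofReal_mul (p.2.1 x), ENNReal.ofReal_toReal (PMF.apply_ne_top _ _)]
  simp only [h]
  rw [Finset.prod_univ_sum, Fintype.piFinset_univ]

theorem Protocol.tsum_messageProb (P : Protocol 𝒲 𝒰 n) (p : Distribution k) (r : 𝒰) :
    ∑' y, P.messageProb p r y = 1 := by
  simp only [P.messageProb_eq]
  exact tsum_transcriptProb (P.step_nonneg p r) fun _ _ => hasSum_outputProb p _

/-- Two laws that are close in Hellinger distance cannot be told apart. -/
theorem ofReal_mul_add_ofReal_mul_le {a b u : ℝ} (ha : 0 ≤ a) (hb : 0 ≤ b) (hu : |u| ≤ 1) :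
    ENNReal.ofReal a * ENNReal.ofReal (1 + u) + ENNReal.ofReal b * ENNReal.ofReal (1 - u) ≤
      ENNReal.ofReal (11 / 10) * (ENNReal.ofReal a + ENNReal.ofReal b) +
        ENNReal.ofReal 5 * ENNReal.ofReal ((√a - √b) ^ 2) := by
  obtain ⟨hu1, hu2⟩ := abs_le.1 hu
  rw [← ENNReal.ofReal_mul ha, ← ENNReal.ofReal_mul hb, ← ENNReal.ofReal_add ha hb,
    ← ENNReal.ofReal_add (mul_nonneg ha (by linarith)) (mul_nonneg hb (by linarith)),
    ← ENNReal.ofReal_mul (by norm_num), ← ENNReal.ofReal_mul (by norm_num),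
    ← ENNReal.ofReal_add (by positivity) (by positivity)]
  apply ENNReal.ofReal_le_ofReal
  obtain ⟨x, hx, rfl⟩ : ∃ x, 0 ≤ x ∧ x ^ 2 = a := ⟨√a, Real.sqrt_nonneg a, Real.sq_sqrt ha⟩
  obtain ⟨y, hy, rfl⟩ : ∃ y, 0 ≤ y ∧ y ^ 2 = b := ⟨√b, Real.sqrt_nonneg b, Real.sq_sqrt hb⟩
  rw [Real.sqrt_sq hx, Real.sqrt_sq hy]
  have h1 : u * (x ^ 2 - y ^ 2) ≤ |x ^ 2 - y ^ 2| := by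
    calc u * (x ^ 2 - y ^ 2) ≤ |u| * |x ^ 2 - y ^ 2| := by rw [← abs_mul]; exact le_abs_self _
      _ ≤ 1 * |x ^ 2 - y ^ 2| := by gcongr
      _ = _ := one_mul _
  -- AM-GM on `|x - y| (x + y)`, with weights that keep the multiple of `x² + y²` small: the
  -- resulting `11/10` must stay below the correlation `4/3` per pair that a good estimate achieves.
  have h2 : |x ^ 2 - y ^ 2| ≤ 5 * (x - y) ^ 2 + (x ^ 2 + y ^ 2) / 10 := by
    rw [abs_le]
    constructor <;> nlinarith [sq_nonneg (10 * (x - y) - (x + y)),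
      sq_nonneg (10 * (x - y) + (x + y)), sq_nonneg (x - y)]
  linarith

theorem sum_flipAt {M : Type*} [AddCommMonoid M] (i : Fin k) (f : (Fin k → Bool) → M) :
    ∑ z, f (flipAt i z) = ∑ z, f z :=
  Equiv.sum_comp (flipAt_involutive i).toPerm f

/-- The total information that the transcript provides about the directions of the
perturbations. -/
theorem sum_sum_hellinger_le (hk : 1 ≤ k) {γ : ℝ} (hγ : 0 ≤ γ) (hγ1 : γ ≤ 3 / 4)
    (P : Protocol 𝒲 𝒰 n) (r : 𝒰) :
    ∑ i, ∑ z, ∑' y, ENNReal.ofReal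
        ((√(transcriptProb (P.step (perturbed hk hγ (hγ1.trans (by norm_num)) z) r) y) -
          √(transcriptProb (P.step
            (perturbed hk hγ (hγ1.trans (by norm_num)) (flipAt i z)) r) y)) ^ 2) ≤
      2 ^ k * (n * (ENNReal.ofReal (4 * γ ^ 2 / k) * familyNuclearNorm 𝒲)) := by
  set p := fun z => perturbed hk hγ (hγ1.trans (by norm_num)) z with hp
  set d : Fin k → (t : Fin n) → (Fin (t : ℕ) → 𝒴) → ℝ≥0∞ := fun i t h =>
    ENNReal.ofReal (4 * γ ^ 2 / k) * ENNReal.ofReal (infoMatrix (P.channel t h r) i i) with hd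
  have h1 : ∀ i, ∑ z, ∑' y, ENNReal.ofReal ((√(transcriptProb (P.step (p z) r) y) -
      √(transcriptProb (P.step (p (flipAt i z)) r) y)) ^ 2) ≤
      ∑ z, ∑' y, P.messageProb (p z) r y * ∑ t, d i t (past y t) := fun i => by
    calc _ ≤ ∑ z, 2⁻¹ * ∑' y, (P.messageProb (p z) r y + P.messageProb (p (flipAt i z)) r y) *
          ∑ t, d i t (past y t) := by
          refine Finset.sum_le_sum fun z _ => ?_
          simp only [P.messageProb_eq]
          exact tsum_sq_sqrt_transcriptProb_le (P.step_nonneg _ r) (P.step_nonneg _ r)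
            (fun _ _ => hasSum_outputProb _ _) (fun _ _ => hasSum_outputProb _ _) (d i)
            fun t h => tsum_sq_sqrt_outputProb_le hk hγ hγ1 z i _
      _ = _ := by
          simp only [add_mul, ENNReal.tsum_add]
          -- Averaged over all `z`, the flipped law contributes as much as the original one, which
          -- cancels the factor `2⁻¹`.
          rw [← Finset.mul_sum, Finset.sum_add_distrib,
            sum_flipAt i fun z => ∑' y, P.messageProb (p z) r y * ∑ t, d i t (past y t),
            ← two_mul, ← mul_assoc, ENNReal.inv_mul_cancel two_ne_zero ENNReal.ofNat_ne_top,
            one_mul]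
  refine (Finset.sum_le_sum fun i _ => h1 i).trans ?_
  rw [Finset.sum_comm]
  have h2 : ∀ z, ∑ i, ∑' y, P.messageProb (p z) r y * ∑ t, d i t (past y t) ≤
      n * (ENNReal.ofReal (4 * γ ^ 2 / k) * familyNuclearNorm 𝒲) := fun z => by
    rw [← Summable.tsum_finsetSum fun _ _ => ENNReal.summable]
    calc _ ≤ ∑' y, P.messageProb (p z) r y *
          (n * (ENNReal.ofReal (4 * γ ^ 2 / k) * familyNuclearNorm 𝒲)) := by
          refine ENNReal.tsum_le_tsum fun y => ?_
          rw [← Finset.mul_sum, Finset.sum_comm]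
          gcongr
          refine (Finset.sum_le_sum (g := fun _ => ENNReal.ofReal (4 * γ ^ 2 / k) *
            familyNuclearNorm 𝒲) fun t _ => ?_).trans_eq (by simp)
          rw [hd, ← Finset.mul_sum]
          gcongr
          exact sum_ofReal_infoMatrix_diag_le (P.channel_mem _ _ _)
      _ = _ := by rw [ENNReal.tsum_mul_right, P.tsum_messageProb, one_mul]
  refine (Finset.sum_le_sum fun z _ => h2 z).trans_eq ?_
  simp

/-! ### Fixing the public randomness -/

open Classical in
/-- The probability of failure for a fixed value of the public randomness. -/
noncomputable def Protocol.condFailureProb (P : Protocol 𝒲 𝒰 n)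
    (est : (Fin n → 𝒴) → 𝒰 → Distribution k) (ε : ℝ) (p : Distribution k) (r : 𝒰) : ℝ≥0∞ :=
  ∑' y : Fin n → 𝒴, if ε < tvDist (est y r) p then P.messageProb p r y else 0

theorem continuous_tvDist (p : Distribution k) : Continuous fun q => tvDist q p := by
  unfold tvDist
  simp only [← Finset.sup'_univ_eq_ciSup]
  refine Continuous.finset_sup'_apply _ fun S _ => ?_
  fun_prop

/-- Countability of `𝒴` makes the transcripts countable, so the series of measurable functions is
measurable. -/
theorem Protocol.measurable_condFailureProb [Countable 𝒴] (P : Protocol 𝒲 𝒰 n)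
    {est : (Fin n → 𝒴) → 𝒰 → Distribution k} (hest : ∀ y, Measurable (est y)) (ε : ℝ)
    (p : Distribution k) : Measurable (P.condFailureProb est ε p) := by
  unfold Protocol.condFailureProb
  refine Measurable.tsum fun y => ?_
  refine Measurable.ite ?_ ?_ measurable_const
  · exact measurableSet_lt measurable_const ((continuous_tvDist p).measurable.comp (hest y))
  · unfold Protocol.messageProb
    exact Finset.measurable_sum _ fun x _ => Finset.measurable_prod _ fun t _ =>
      (P.measurable_channel t _ _ _).const_mul _

/-- Some value of the public randomness is good for the average perturbation. -/
theorem Protocol.exists_sum_condFailureProb_le [Countable 𝒴] (P : Protocol 𝒲 𝒰 n)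
    (μ : Measure 𝒰) [IsProbabilityMeasure μ]
    {est : (Fin n → 𝒴) → 𝒰 → Distribution k} (hest : ∀ y, Measurable (est y)) {ε : ℝ}
    {η : ℝ≥0∞} (h : ∀ p, P.failureProb μ est ε p ≤ η) {ι : Type*} [Fintype ι]
    (p : ι → Distribution k) :
    ∃ r, ∑ z, P.condFailureProb est ε (p z) r ≤ Fintype.card ι * η := by
  have h1 : ∫⁻ r, ∑ z, P.condFailureProb est ε (p z) r ∂μ ≤ Fintype.card ι * η := by
    rw [lintegral_finsetSum _ fun z _ => P.measurable_condFailureProb hest ε (p z)]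
    exact (Finset.sum_le_sum fun z _ => h (p z)).trans_eq (by simp)
  obtain ⟨r, hr⟩ := exists_le_lintegral (μ := μ)
    (Finset.measurable_sum Finset.univ fun z _ =>
      P.measurable_condFailureProb hest ε (p z)).aemeasurable
  exact ⟨r, hr.trans h1⟩

/-! ### Correlation of the estimate with the signs -/

/-- If an estimator succeeds, then its estimate is correlated with the perturbation. -/
theorem Protocol.le_tsum_messageProb_mul_add (hk : 1 ≤ k) {γ ε : ℝ} (hγ : 0 < γ) (hγ1 : γ ≤ 1)
    (P : Protocol 𝒲 𝒰 n) (est : (Fin n → 𝒴) → 𝒰 → Distribution k) (r : 𝒰)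
    (z : Fin k → Bool) :
    ENNReal.ofReal (2 * k * (1 - ε / γ)) ≤
      ∑ i, ∑' y, P.messageProb (perturbed hk hγ.le hγ1 z) r y *
        ENNReal.ofReal (1 + boolSign (z i) * softSign γ (est y r) i) +
      ENNReal.ofReal (2 * k * (1 - ε / γ)) *
        P.condFailureProb est ε (perturbed hk hγ.le hγ1 z) r := by
  set p := perturbed hk hγ.le hγ1 z
  rw [← Summable.tsum_finsetSum fun _ _ => ENNReal.summable, Protocol.condFailureProb,
    ← ENNReal.tsum_mul_left, ← ENNReal.tsum_add]
  calc ENNReal.ofReal (2 * k * (1 - ε / γ))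
      = ∑' y, P.messageProb p r y * ENNReal.ofReal (2 * k * (1 - ε / γ)) := by
        rw [ENNReal.tsum_mul_right, P.tsum_messageProb, one_mul]
    _ ≤ _ := by
        refine ENNReal.tsum_le_tsum fun y => ?_
        -- On failure the second term alone supplies the bound; on success the correlation does.
        split_ifs with h
        · rw [mul_comm]
          exact le_add_self
        · rw [mul_zero, add_zero, ← Finset.mul_sum, ← ENNReal.ofReal_sum_of_nonneg fun i _ => ?_]
          · gcongr
            exact le_sum_one_add_boolSign_mul_softSign hk hγ hγ1 z (not_lt.1 h)
          · have h1 := abs_le.1 (abs_softSign_le γ (est y r) i)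
            rcases boolSign_eq (z i) with h2 | h2 <;> rw [h2] <;> linarith

/-- The correlation of an estimate with the direction of one perturbation is bounded by the
information that the transcript provides about it. -/
theorem Protocol.two_mul_sum_tsum_messageProb_mul_le (P : Protocol 𝒲 𝒰 n) (r : 𝒰)
    (p : (Fin k → Bool) → Distribution k) (i : Fin k) {δ : (Fin n → 𝒴) → ℝ} (hδ : ∀ y, |δ y| ≤ 1) :
    2 * ∑ z, ∑' y, P.messageProb (p z) r y * ENNReal.ofReal (1 + boolSign (z i) * δ y) ≤
      ENNReal.ofReal (11 / 10) * (2 * 2 ^ k) +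
      ENNReal.ofReal 5 * ∑ z, ∑' y, ENNReal.ofReal ((√(transcriptProb (P.step (p z) r) y) -
          √(transcriptProb (P.step (p (flipAt i z)) r) y)) ^ 2) := by
  -- Reindexing one of the two copies by `flipAt i` turns `1 + u` into `1 - u`, which leaves a
  -- two-point comparison of `z` with its flip.
  calc _ = ∑ z, ∑' y, (P.messageProb (p z) r y * ENNReal.ofReal (1 + boolSign (z i) * δ y) +
          P.messageProb (p (flipAt i z)) r y * ENNReal.ofReal (1 - boolSign (z i) * δ y)) := by
        simp only [ENNReal.tsum_add]
        rw [Finset.sum_add_distrib, two_mul]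
        congr 1
        rw [← sum_flipAt i]
        simp only [flipAt_same, boolSign_not, neg_mul, sub_eq_add_neg]
    _ ≤ ∑ z, ∑' y, (ENNReal.ofReal (11 / 10) *
          (P.messageProb (p z) r y + P.messageProb (p (flipAt i z)) r y) +
          ENNReal.ofReal 5 * ENNReal.ofReal ((√(transcriptProb (P.step (p z) r) y) -
            √(transcriptProb (P.step (p (flipAt i z)) r) y)) ^ 2)) := by
        refine Finset.sum_le_sum fun z _ => ENNReal.tsum_le_tsum fun y => ?_
        simp only [P.messageProb_eq]
        refine ofReal_mul_add_ofReal_mul_le (transcriptProb_nonneg (P.step_nonneg _ r) y)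
          (transcriptProb_nonneg (P.step_nonneg _ r) y) ?_
        rcases boolSign_eq (z i) with h | h <;> simpa [h] using hδ y
    _ = _ := by
        simp only [ENNReal.tsum_add, ENNReal.tsum_mul_left, P.tsum_messageProb]
        rw [Finset.sum_add_distrib, Finset.mul_sum]
        congr 1
        simp
        ring

theorem le_mul_familyNuclearNorm [Countable 𝒴] (hk : 1 ≤ k) {ε : ℝ} (hε : 0 < ε)
    (hε1 : ε ≤ 1 / 4) (h : HasEstimator.{u, v} 𝒲 n ε) (hT : familyNuclearNorm 𝒲 ≠ ∞) :
    ENNReal.ofReal (1 / 500) * (k : ℝ≥0∞) ^ 2 ≤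
      n * (ENNReal.ofReal ε ^ 2 * familyNuclearNorm 𝒲) := by
  obtain ⟨𝒰, _, μ, _, P, est, hest, hfail⟩ := h
  -- With `γ = 3ε` the correlation bound is `2k(1 - 1/3) = 4k/3`, above the value `k` of a blind
  -- guess, and `ε ≤ 1/4` gives `γ ≤ 3/4`.
  have hγ : 0 < 3 * ε := by positivity
  have hγ' : 3 * ε ≤ 3 / 4 := by linarith
  have hγ1 : 3 * ε ≤ 1 := by linarith
  obtain ⟨r, hr⟩ := P.exists_sum_condFailureProb_le μ hest (fun p => (iSup_le_iff.1 hfail) p)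
    (perturbed hk hγ.le hγ1)
  have hk' : (0 : ℝ) < k := by positivity
  have hlow := Finset.sum_le_sum fun z (_ : z ∈ Finset.univ) =>
    P.le_tsum_messageProb_mul_add (ε := ε) hk hγ hγ1 est r z
  have hup := Finset.sum_le_sum fun i (_ : i ∈ Finset.univ) =>
    P.two_mul_sum_tsum_messageProb_mul_le r (perturbed hk hγ.le hγ1) i
      (δ := fun y => softSign (3 * ε) (est y r) i) fun y => abs_softSign_le _ _ _
  have hinfo := sum_sum_hellinger_le hk hγ.le hγ' P r
  have hc : 2 * (k : ℝ) * (1 - ε / (3 * ε)) = 4 / 3 * k := by field_simp; norm_num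
  rw [Finset.sum_add_distrib, ← Finset.mul_sum, Finset.sum_comm, hc] at hlow
  rw [← Finset.mul_sum, Finset.sum_add_distrib] at hup
  simp only [Finset.sum_const, Finset.card_univ, Fintype.card_fin, Fintype.card_pi,
    Fintype.card_bool, Finset.prod_const, nsmul_eq_mul] at hlow hup hr
  rw [← Finset.mul_sum] at hup
  -- Finiteness of the norm allows a passage to real numbers, where terms can be subtracted.
  obtain ⟨τ, hτ, hτT⟩ : ∃ τ : ℝ, 0 ≤ τ ∧ familyNuclearNorm 𝒲 = ENNReal.ofReal τ :=
    ⟨_, ENNReal.toReal_nonneg, (ENNReal.ofReal_toReal hT).symm⟩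
  have hall : 2 * ENNReal.ofReal (2 ^ k * (4 / 3 * k)) ≤
      ENNReal.ofReal (k * (11 / 10 * (2 * 2 ^ k))) +
      ENNReal.ofReal (5 * (2 ^ k * (n * (4 * (3 * ε) ^ 2 / k * τ)))) +
      2 * ENNReal.ofReal (4 / 3 * k * (2 ^ k * (1 / 100))) := by
    have e1 : ENNReal.ofReal (2 ^ k * (4 / 3 * k)) = ((2 ^ k : ℕ) : ℝ≥0∞) *
        ENNReal.ofReal (4 / 3 * k) := by
      rw [ENNReal.ofReal_mul (by positivity)]; simp [ENNReal.ofReal_pow]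
    have e2 : ENNReal.ofReal (k * (11 / 10 * (2 * 2 ^ k))) =
        k * (ENNReal.ofReal (11 / 10) * (2 * 2 ^ k)) := by
      rw [ENNReal.ofReal_mul (by positivity), ENNReal.ofReal_mul (by positivity),
        ENNReal.ofReal_mul (by positivity)]
      simp [ENNReal.ofReal_pow]
    have e3 : ENNReal.ofReal (5 * (2 ^ k * (n * (4 * (3 * ε) ^ 2 / k * τ)))) =
        ENNReal.ofReal 5 * (2 ^ k * (n * (ENNReal.ofReal (4 * (3 * ε) ^ 2 / k) *
          familyNuclearNorm 𝒲))) := by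
      rw [ENNReal.ofReal_mul (by positivity), ENNReal.ofReal_mul (by positivity),
        ENNReal.ofReal_mul (by positivity), ENNReal.ofReal_mul (by positivity), hτT]
      simp [ENNReal.ofReal_pow]
    have e4 : ENNReal.ofReal (4 / 3 * k * (2 ^ k * (1 / 100))) =
        ENNReal.ofReal (4 / 3 * k) * (((2 ^ k : ℕ) : ℝ≥0∞) * (1 / 100)) := by
      rw [ENNReal.ofReal_mul (by positivity), ENNReal.ofReal_mul (by positivity),
        ENNReal.ofReal_div_of_pos (by norm_num)]
      simp [ENNReal.ofReal_pow]
    rw [e1, e2, e3, e4]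
    calc _ ≤ 2 * (_ + _) := mul_le_mul_right hlow 2
      _ = 2 * _ + 2 * _ := mul_add _ _ _
      _ ≤ _ := by
        gcongr
        refine hup.trans ?_
        gcongr
  rw [← ENNReal.ofReal_ofNat 2, ← ENNReal.ofReal_mul (by norm_num),
    ← ENNReal.ofReal_mul (by norm_num), ← ENNReal.ofReal_add (by positivity) (by positivity),
    ← ENNReal.ofReal_add (by positivity) (by positivity),
    ENNReal.ofReal_le_ofReal_iff (by positivity)] at hall
  -- Here `8/3 - 11/5 - 2/75 = 44/100` and `5 · 4 · 3² = 180`; the constant works because `0.44 /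
  -- 180 > 1/500`.
  have hreal : 1 / 500 * (k : ℝ) ^ 2 ≤ n * (ε ^ 2 * τ) := by
    have h2 : (0 : ℝ) < 2 ^ k := by positivity
    have h3 : (2 : ℝ) ^ k * (44 / 100 * k) ≤ 2 ^ k * (180 * (n * (ε ^ 2 * τ)) / k) := by
      have : 5 * ((2 : ℝ) ^ k * (n * (4 * (3 * ε) ^ 2 / k * τ))) =
        2 ^ k * (180 * (n * (ε ^ 2 * τ)) / k) := by ring
      linarith
    have h4 := (le_div_iff₀ hk').1 (le_of_mul_le_mul_left h3 h2)
    nlinarith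
  have := ENNReal.ofReal_le_ofReal hreal
  rw [ENNReal.ofReal_mul (by norm_num), ENNReal.ofReal_mul (by positivity),
    ENNReal.ofReal_mul (by positivity), ENNReal.ofReal_pow (by positivity),
    ENNReal.ofReal_pow hε.le, ENNReal.ofReal_natCast, ENNReal.ofReal_natCast] at this
  rwa [hτT]

end

end InteractiveLearning

theorem mainTheorem1 :
    ∃ c : ℝ, 0 < c ∧
      ∀ (k : ℕ), 1 ≤ k → ∀ (𝒴 : Type u) [Countable 𝒴]
        (𝒲 : Set (InteractiveLearning.Channel k 𝒴)) (ε : ℝ), 0 < ε → ε ≤ 1 / 4 →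
        ENNReal.ofReal c * ((k : ℝ≥0∞) ^ 2 /
            (ENNReal.ofReal ε ^ 2 * InteractiveLearning.familyNuclearNorm 𝒲)) ≤
          ((InteractiveLearning.sampleComplexity.{u, v} 𝒲 ε : ℕ∞) : ℝ≥0∞) := by
  refine ⟨1 / 500, by norm_num, fun k hk 𝒴 _ 𝒲 ε hε hε1 => ?_⟩
  have hle : ∀ n, InteractiveLearning.HasEstimator.{u, v} 𝒲 n ε →
      ENNReal.ofReal (1 / 500) * ((k : ℝ≥0∞) ^ 2 /
        (ENNReal.ofReal ε ^ 2 * InteractiveLearning.familyNuclearNorm 𝒲)) ≤ n := fun n h => by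
    -- An infinite norm makes the bound `0`. A zero norm falls under the other case: the quotient is
    -- then `∞`, and the inequality with right-hand side `0` rules out every estimator.
    by_cases hT : InteractiveLearning.familyNuclearNorm 𝒲 = ∞
    · rw [hT, ENNReal.mul_top (by simp [hε]), ENNReal.div_top, mul_zero]
      exact zero_le
    · rw [← mul_div_assoc]
      exact ENNReal.div_le_of_le_mul
        (InteractiveLearning.le_mul_familyNuclearNorm hk hε hε1 h hT)
  unfold InteractiveLearning.sampleComplexity
  simp only [ENat.toENNReal_iInf]
  exact le_iInf₂ fun n h => by simpa using hle n h
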